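/- Let $\lambda_1,\lambda_2,\lambda_3$ be positive integers, and let $S(3;\lambda_1,\lambda_2,\lambda_3)$ be the sun graph obtained from a triangle with vertices $v_1,v_2,v_3$ and three disjoint paths $P_{\lambda_1},P_{\lambda_2},P_{\lambda_3}$, where $P_m$ denotes the path on $m$ vertices, by joining $v_i$ by an edge to an end vertex of $P_{\lambda_i}$ for $i=1,2,3$. A connected partition of a finite graph $G$ of type $\mu$, where $\mu=(\mu_1,\dots,\mu_k)$ is an integer partition of $|V(G)|$, is a partition of $V(G)$ into blocks of sizes $\mu_1,\dots,\mu_k$, each of which induces a connected subgraph. The chromatic symmetric function of $G$ is $X_G=\sum_{\kappa}\prod_{v\in V(G)}x_{\kappa(v)}\in\mathbb{Q}[[x_1,x_2,\dots]]$, the sum being over all proper colourings $\kappa$ of $G$ with positive integers. The graph $G$ is called $e$-positive if, when $X_G$ is written in the basis $\{e_\lambda\}$ of elementary symmetric functions $e_\lambda=e_{\lambda_1}e_{\lambda_2}\cdots$ ($\lambda$ an integer partition), all the coefficients are nonnegative. Theorem. If $\lambda_1=\max\{\lambda_1,\lambda_2,\lambda_3\}$ and $\lambda_1<\lambda_2+\lambda_3$,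 then $S(3;\lambda_1,\lambda_2,\lambda_3)$ has no connected partition of type $(\lambda_2+\lambda_3+1,\lambda_1+2)$. Moreover, $S(3;\lambda_1,\lambda_2,\lambda_3)$ is not $e$-positive. -/

import Mathlib

noncomputable section

/-- Vertices of the sun `S(n; r 0, …, r (n-1))`: the pair `(i, 0)` is the vertex `v_i` of the
body, and `(i, 1), …, (i, r i)` are the consecutive vertices of the `i`-th ray, which is a path
on `r i` vertices. -/
abbrev SunVertex (n : ℕ) (r : Fin n → ℕ) : Type := Σ i : Fin n, Fin (r i + 1)

/-- The (ordinary) sun graph `S(n; r 0, …, r (n-1))`, for `n ≥ 3`: the body vertices `(i, 0)`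
form the cycle `C_n`, each ray is a path, and the end `(i, 1)` of the `i`-th ray is joined
to `(i, 0)`. -/
def sunGraph (n : ℕ) (r : Fin n → ℕ) : SimpleGraph (SunVertex n r) where
  Adj x y :=
    (x.2.val = 0 ∧ y.2.val = 0 ∧ (SimpleGraph.cycleGraph n).Adj x.1 y.1) ∨
      (x.1 = y.1 ∧ (x.2.val + 1 = y.2.val ∨ y.2.val + 1 = x.2.val))
  symm := ⟨by
    rintro x y (⟨hx, hy, h⟩ | ⟨h, h'⟩)
    · exact Or.inl ⟨hy, hx, h.symm⟩
    · exact Or.inr ⟨h.symm, h'.symm⟩⟩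
  loopless := ⟨by
    rintro x (⟨_, _, h⟩ | ⟨_, h⟩)
    · exact h.ne rfl
    · omega⟩

/-- `G` has a connected partition of type `μ` (a multiset of positive integers): there is a
partition of the vertex set into nonempty blocks, each inducing a connected subgraph,
such that the multiset of block sizes is `μ`. -/
def HasConnectedPartition {V : Type*} [Fintype V] [DecidableEq V] (G : SimpleGraph V)
    (μ : Multiset ℕ) : Prop :=
  ∃ P : Finpartition (Finset.univ : Finset V),
    (∀ B ∈ P.parts, (G.induce (B : Set V)).Connected) ∧ P.parts.val.map Finset.card = μ

/-- The formal sum of monomials `∑ i, x ^ (f i)` in `ℚ⟦x_0, x_1, …⟧`: the coefficient of `x ^ m`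
is the number of indices `i` with `f i = m`. It is used only for families in which each monomial
occurs finitely often (see the two finiteness facts below). -/
def monomialSum {ι : Type*} (f : ι → (ℕ →₀ ℕ)) : MvPowerSeries ℕ ℚ :=
  fun m => (Nat.card {i : ι // f i = m} : ℚ)

/-- The `k`-th elementary symmetric function `e_k = ∑_{j_1 < ⋯ < j_k} x_{j_1} ⋯ x_{j_k}`;
in particular `e_0 = 1`. -/
def elemSymm (k : ℕ) : MvPowerSeries ℕ ℚ :=
  monomialSum fun s : {s : Finset ℕ // s.card = k} => ∑ j ∈ s.1, Finsupp.single j 1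

theorem finite_elemSymm_fiber (k : ℕ) (m : ℕ →₀ ℕ) :
    Finite {s : {s : Finset ℕ // s.card = k} // ∑ j ∈ s.1, Finsupp.single j 1 = m} := by
  refine Finite.of_injective
    (β := {t : Finset ℕ // t ∈ m.support.powerset})
    (fun s => ⟨s.1.1, ?_⟩) ?_
  · rw [Finset.mem_powerset]
    intro j hj
    rw [Finsupp.mem_support_iff, ← s.2, Finsupp.finsetSum_apply]
    simp [Finsupp.single_apply, hj]
  · intro s t h
    exact Subtype.ext (Subtype.ext (Subtype.mk.inj h))

/-- `e_λ = e_{λ_1} e_{λ_2} ⋯` for a partition `λ`. -/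
def elemSymmPart {n : ℕ} (p : n.Partition) : MvPowerSeries ℕ ℚ :=
  (p.parts.map elemSymm).prod

/-- A symmetric function is `e`-positive if it is a (finite) linear combination of the basis
elements `e_λ`, over all integer partitions `λ`, with nonnegative coefficients. -/
def EPositive (f : MvPowerSeries ℕ ℚ) : Prop :=
  ∃ c : (Σ n : ℕ, n.Partition) →₀ ℚ,
    (∀ p, 0 ≤ c p) ∧ f = c.sum fun p a => a • elemSymmPart p.2

/-- The chromatic symmetric function `X_G = ∑_k ∏_v x_{k(v)}`, the sum being over
all proper colourings `k : V → ℕ` of `G`. -/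
def chromaticSymm {V : Type*} [Fintype V] (G : SimpleGraph V) : MvPowerSeries ℕ ℚ :=
  monomialSum fun k : G.Coloring ℕ => ∑ v, Finsupp.single (k v) 1

theorem finite_chromaticSymm_fiber {V : Type*} [Fintype V] (G : SimpleGraph V) (m : ℕ →₀ ℕ) :
    Finite {k : G.Coloring ℕ // ∑ v, Finsupp.single (k v) 1 = m} := by
  refine Finite.of_injective (β := V → m.support) (fun k v => ⟨k.1 v, ?_⟩) ?_
  · rw [Finsupp.mem_support_iff]
    intro h
    have hk := DFunLike.congr_fun k.2 (k.1 v)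
    rw [h, Finsupp.finsetSum_apply] at hk
    have := (Finset.sum_eq_zero_iff.mp hk) v (Finset.mem_univ v)
    simp at this
  · intro k l h
    refine Subtype.ext (RelHom.ext fun v => ?_)
    exact congrArg Subtype.val (congrFun h v)

end

open Finset

/-! The excluded type has two parts, each larger than every leg (a body vertex with its ray). A
connected block larger than every leg meets the triangle in at least two vertices, and two such
blocks would need four.

Failure of `e`-positivity follows from a criterion (`EPositive.hasConnectedPartition_pair`) proved
by specialising `X_G` at roots of unity. With `n = a + b` vertices, the `n` variables `-ω^i y` have
`e_n = -y^n` and `e_k = 0` for every other `k > 0`. Hence if the sum of `∏ ω^(k v)` over proper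
colourings is nonzero, any expansion of `X_G` involves `e_n`.

Now take `a + b` variables `-ω_a^i α`, `-ω_b^j β`. Their generating polynomial is `(X^a - α^a)(X^b -
β^b)`, so every `e_λ` becomes a polynomial in `-α^a`, `-β^b` with natural coefficients. Its
coefficient at `α^a β^b` is a natural number, equal to 1 for `e_(a+b)`. In `X_G` that coefficient is
a sum over vertex sets `A` of size `a`. If `A` or its complement is disconnected, rotating the
colours on a proper union of components shows that the contribution of `A` is zero. Without a
connected partition of type `(a, b)` the coefficient vanishes, and nonnegativity forces the
coefficient of `e_(a+b)` to be 0, a contradiction.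

For the sun the cyclic sum is `±2n`. -/

/-! ### Restriction to finitely many variables -/

theorem killCompl_monomialSum {ι J σ : Type*} [Fintype J] (e : σ ↪ ℕ) (f : ι → ℕ →₀ ℕ)
    (g : J → σ →₀ ℕ) (j : J → ι) (hj : j.Injective) (hfg : ∀ x, f (j x) = (g x).embDomain e)
    (hsurj : ∀ i m, f i = Finsupp.embDomain e m → ∃ x, j x = i) :
    MvPowerSeries.killCompl e (monomialSum f) =
      ((∑ x, MvPolynomial.monomial (g x) (1 : ℚ) : MvPolynomial σ ℚ) : MvPowerSeries σ ℚ) := by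
  classical
  ext m
  rw [MvPowerSeries.coeff_killCompl, MvPolynomial.coeff_coe, MvPolynomial.coeff_sum]
  simp only [MvPolynomial.coeff_monomial, sum_boole]
  change (Nat.card {i : ι // f i = m.embDomain e} : ℚ) = _
  rw [← Fintype.card_subtype, ← Nat.card_eq_fintype_card]
  congr 1
  refine (Nat.card_congr (Equiv.ofBijective
    (fun x : {x // g x = m} => ⟨j x.1, by rw [hfg, x.2]⟩) ⟨?_, ?_⟩)).symm
  · intro x y h
    exact Subtype.ext (hj (Subtype.mk.inj h))
  · rintro ⟨i, hi⟩
    obtain ⟨x, rfl⟩ := hsurj i m hi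
    exact ⟨⟨x, Finsupp.embDomain_injective e ((hfg x).symm.trans hi)⟩, rfl⟩

theorem embDomain_sum_single {ι σ : Type*} (e : σ ↪ ℕ) (s : Finset ι) (k : ι → σ) :
    (∑ i ∈ s, Finsupp.single (k i) 1).embDomain e = ∑ i ∈ s, Finsupp.single (e (k i)) 1 := by
  simp only [Finsupp.embDomain_eq_mapDomain, Finsupp.mapDomain_finsetSum,
    Finsupp.mapDomain_single]

theorem mem_range_of_sum_single_eq_embDomain {ι σ : Type*} {e : σ ↪ ℕ} {s : Finset ι} {k : ι → ℕ}
    {m : σ →₀ ℕ} (h : ∑ i ∈ s, Finsupp.single (k i) 1 = m.embDomain e) {i : ι} (hi : i ∈ s) :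
    k i ∈ Set.range e := by
  by_contra hk
  have h1 := DFunLike.congr_fun h (k i)
  rw [Finsupp.embDomain_of_notMem_range _ _ _ hk, Finsupp.finsetSum_apply] at h1
  have := sum_eq_zero_iff.mp h1 i hi
  simp at this

theorem killCompl_elemSymm {σ : Type*} [Fintype σ] (e : σ ↪ ℕ) (k : ℕ) :
    MvPowerSeries.killCompl e (elemSymm k) = (MvPolynomial.esymm σ ℚ k : MvPowerSeries σ ℚ) := by
  classical
  rw [MvPolynomial.esymm_eq_sum_subtype]
  have hX : ∀ t : Finset σ, ∏ i ∈ t, (MvPolynomial.X i : MvPolynomial σ ℚ) =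
      MvPolynomial.monomial (∑ i ∈ t, Finsupp.single i 1) 1 := fun t => by
    rw [MvPolynomial.monomial_sum_one]; rfl
  simp only [hX]
  refine killCompl_monomialSum e _ _ (fun t => ⟨t.1.map e, by rw [card_map, t.2]⟩) ?_ ?_ ?_
  · intro s t h
    exact Subtype.ext (map_injective e (Subtype.mk.inj h))
  · intro t
    rw [embDomain_sum_single, sum_map]
  · rintro ⟨s, hs⟩ m h
    have hs' : ∀ x ∈ s, x ∈ Set.range e := fun x hx =>
      mem_range_of_sum_single_eq_embDomain (k := id) h hx
    have hmap : (s.preimage e e.injective.injOn).map e = s := by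
      ext x
      simp only [mem_map, mem_preimage]
      constructor
      · rintro ⟨y, hy, rfl⟩; exact hy
      · intro hx
        obtain ⟨y, rfl⟩ := hs' x hx
        exact ⟨y, hx, rfl⟩
    exact ⟨⟨s.preimage e e.injective.injOn, by rw [← hs, ← card_map e, hmap]⟩, Subtype.ext hmap⟩

open Classical in
/-- The proper colourings of `G` by `σ`, as functions. -/
noncomputable def properColorings {V : Type*} [Fintype V] (G : SimpleGraph V) (σ : Type*) [Fintype σ] :
    Finset (V → σ) :=
  {k | ∀ u v, G.Adj u v → k u ≠ k v}

theorem mem_properColorings {V σ : Type*} [Fintype V] [Fintype σ] {G : SimpleGraph V}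
    {k : V → σ} : k ∈ properColorings G σ ↔ ∀ u v, G.Adj u v → k u ≠ k v := by
  simp [properColorings]

theorem killCompl_chromaticSymm {V σ : Type*} [Fintype V] [Fintype σ] (G : SimpleGraph V)
    (e : σ ↪ ℕ) :
    MvPowerSeries.killCompl e (chromaticSymm G) =
      ((∑ k ∈ properColorings G σ, ∏ v, MvPolynomial.X (k v) : MvPolynomial σ ℚ) :
        MvPowerSeries σ ℚ) := by
  classical
  have hX : ∀ k : V → σ, ∏ v, (MvPolynomial.X (k v) : MvPolynomial σ ℚ) =
      MvPolynomial.monomial (∑ v, Finsupp.single (k v) 1) 1 := fun t => by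
    rw [MvPolynomial.monomial_sum_one]; rfl
  simp only [hX]
  rw [← sum_coe_sort]
  refine killCompl_monomialSum e _ _
    (fun k => SimpleGraph.Coloring.mk (fun v => e (k.1 v)) fun {u v} huv h =>
      mem_properColorings.mp k.2 u v huv (e.injective h)) ?_ ?_ ?_
  · intro s t h
    exact Subtype.ext (funext fun v => e.injective (DFunLike.congr_fun h v))
  · intro t
    rw [embDomain_sum_single]; rfl
  · intro k m h
    choose k' hk' using fun v => mem_range_of_sum_single_eq_embDomain h (mem_univ v)
    refine ⟨⟨k', mem_properColorings.mpr fun u v huv h' => k.valid huv ?_⟩, RelHom.ext hk'⟩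
    rw [← hk', ← hk', h']

/-- Setting all but finitely many variables to zero turns the expansion of `X_G` into an identity of
polynomials, which can then be evaluated at any weights. -/
theorem sum_properColorings_eq {V σ R : Type*} [Fintype V] [Fintype σ] [CommRing R] [Algebra ℚ R]
    {G : SimpleGraph V} {c : (Σ n : ℕ, n.Partition) →₀ ℚ}
    (hc : chromaticSymm G = c.sum fun p a => a • elemSymmPart p.2) (w : σ → R) :
    ∑ k ∈ properColorings G σ, ∏ v, w (k v) =
      c.sum fun p a => a • (p.2.parts.map (univ.val.map w).esymm).prod := by
  let e : σ ↪ ℕ := (Fintype.equivFin σ).toEmbedding.trans Fin.valEmbedding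
  have h := congrArg (MvPowerSeries.killCompl e) hc
  have h2 : ∀ p : Σ n : ℕ, n.Partition, MvPowerSeries.killCompl e (elemSymmPart p.2) =
      MvPolynomial.coeToMvPowerSeries.ringHom
        (p.2.parts.map (MvPolynomial.esymm σ ℚ)).prod := by
    intro p
    rw [elemSymmPart, map_multiset_prod, map_multiset_prod, Multiset.map_map, Multiset.map_map]
    congr 2
    funext k
    exact killCompl_elemSymm e k
  rw [killCompl_chromaticSymm, Finsupp.sum, map_sum] at h
  simp only [map_smul, h2] at h
  have h3 : (∑ k ∈ properColorings G σ, ∏ v, MvPolynomial.X (k v) : MvPolynomial σ ℚ) =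
      ∑ p ∈ c.support, c p • (p.2.parts.map (MvPolynomial.esymm σ ℚ)).prod := by
    apply MvPolynomial.coe_injective
    rw [h, ← MvPolynomial.coeToMvPowerSeries.ringHom_apply, map_sum]
    refine sum_congr rfl fun p _ => ?_
    simp only [MvPolynomial.coeToMvPowerSeries.ringHom_apply, MvPolynomial.coe_smul]
  have h4 := congrArg (MvPolynomial.aeval w) h3
  simp only [map_sum, map_prod, MvPolynomial.aeval_X, map_smul, map_multiset_prod,
    Multiset.map_map, Function.comp_def, MvPolynomial.aeval_esymm_eq_multiset_esymm] at h4
  exact h4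

/-! ### Specialisation at one cycle of roots of unity -/

theorem prod_sub_stdAddChar_mul {A : Type*} [CommRing A] [IsDomain A] [Algebra ℂ A] (n : ℕ)
    [NeZero n] (x y : A) :
    ∏ i : ZMod n, (x - algebraMap ℂ A (ZMod.stdAddChar i) * y) = x ^ n - y ^ n := by
  classical
  have hinj : Function.Injective fun i : ZMod n => algebraMap ℂ A (ZMod.stdAddChar i) :=
    (algebraMap ℂ A).injective.comp ZMod.injective_stdAddChar
  have hprim : IsPrimitiveRoot (algebraMap ℂ A (Complex.exp (2 * Real.pi * Complex.I / n))) n :=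
    (Complex.isPrimitiveRoot_exp n (NeZero.ne n)).map_of_injective (algebraMap ℂ A).injective
  have himage : univ.image (fun i : ZMod n => algebraMap ℂ A (ZMod.stdAddChar i)) =
      Polynomial.nthRootsFinset n (1 : A) := by
    refine eq_of_subset_of_card_le ?_ ?_
    · intro z hz
      obtain ⟨i, -, rfl⟩ := mem_image.mp hz
      rw [Polynomial.mem_nthRootsFinset (NeZero.pos n), ← map_pow, ← AddChar.map_nsmul_eq_pow]
      simp
    · rw [card_image_of_injective _ hinj, hprim.card_nthRootsFinset, card_univ, ZMod.card]
  rw [hprim.pow_sub_pow_eq_prod_sub_mul x y (NeZero.pos n), ← himage,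
    prod_image fun i _ j _ h => hinj h]

theorem esymm_eq_coeff_prod {σ R : Type*} [Fintype σ] [CommRing R] (w : σ → R) {k : ℕ}
    (hk : k ≤ Fintype.card σ) :
    (univ.val.map w).esymm k =
      (∏ i, (Polynomial.X + Polynomial.C (w i))).coeff (Fintype.card σ - k) := by
  rw [Finset.prod_X_add_C_coeff univ w (by simp [card_univ]), card_univ, Nat.sub_sub_self hk,
    Finset.esymm_map_val]

theorem esymm_eq_zero_of_card_lt {σ R : Type*} [Fintype σ] [CommRing R] (w : σ → R) {k : ℕ}
    (hk : Fintype.card σ < k) : (univ.val.map w).esymm k = 0 := by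
  rw [Finset.esymm_map_val, powersetCard_eq_empty.mpr (by rwa [card_univ]), sum_empty]

theorem prod_X_add_C_stdAddChar {R : Type*} [CommRing R] [IsDomain R] [Algebra ℂ R] (n : ℕ)
    [NeZero n] (y : R) :
    ∏ i : ZMod n, (Polynomial.X +
      Polynomial.C (-(algebraMap ℂ R (ZMod.stdAddChar i) * y))) =
      Polynomial.X ^ n - Polynomial.C (y ^ n) := by
  rw [Polynomial.C_pow, ← prod_sub_stdAddChar_mul]
  refine prod_congr rfl fun i _ => ?_
  rw [Polynomial.C_neg, Polynomial.C_mul, ← sub_eq_add_neg]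
  rfl

theorem esymm_stdAddChar {R : Type*} [CommRing R] [IsDomain R] [Algebra ℂ R] (n : ℕ)
    [NeZero n] (y : R) {k : ℕ} (hk : k ≠ 0) :
    (univ.val.map fun i : ZMod n => -(algebraMap ℂ R (ZMod.stdAddChar i) * y)).esymm k =
      if k = n then -y ^ n else 0 := by
  rcases lt_or_ge n k with h | h
  · rw [esymm_eq_zero_of_card_lt _ (by rwa [ZMod.card]), if_neg h.ne']
  · rw [esymm_eq_coeff_prod _ (by rwa [ZMod.card]), prod_X_add_C_stdAddChar, ZMod.card,
      Polynomial.coeff_sub, Polynomial.coeff_X_pow, Polynomial.coeff_C, if_neg (by omega), zero_sub]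
    by_cases hn : k = n
    · simp [hn]
    · rw [if_neg (by omega), if_neg hn, neg_zero]

/-- The sum of `∏ v, ω ^ k v` over the proper colourings `k` of `G` by `ZMod n`, where `ω` is a
primitive `n`-th root of unity. -/
noncomputable def cyclicColoringSum {V : Type*} [Fintype V] (G : SimpleGraph V) (n : ℕ)
    [NeZero n] : ℂ :=
  ∑ k ∈ properColorings G (ZMod n), ∏ v, ZMod.stdAddChar (k v)

/-- The variable `y` records the degree: at `y^n` the colouring side is `±cyclicColoringSum G n`,
while among the `e_λ` only `e_n` has a nonzero coefficient there. -/
theorem exists_parts_eq_singleton {V : Type*} [Fintype V] {G : SimpleGraph V} {n : ℕ} [NeZero n]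
    (hn : Fintype.card V = n) (hG : cyclicColoringSum G n ≠ 0)
    {c : (Σ n : ℕ, n.Partition) →₀ ℚ}
    (hc : chromaticSymm G = c.sum fun p a => a • elemSymmPart p.2) :
    ∃ p ∈ c.support, p.2.parts = {n} := by
  by_contra! hcon
  apply hG
  have h := congrArg (fun f => Polynomial.coeff f n) (sum_properColorings_eq hc
    fun i : ZMod n => -(algebraMap ℂ (Polynomial ℂ) (ZMod.stdAddChar i) * Polynomial.X))
  simp only [Finsupp.sum, Polynomial.finsetSum_coeff] at h
  rw [sum_eq_zero (s := c.support)] at h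
  · have hL : ∀ k : V → ZMod n, (∏ v, -(algebraMap ℂ (Polynomial ℂ) (ZMod.stdAddChar (k v)) *
        Polynomial.X)).coeff n = (-1) ^ n * ∏ v, ZMod.stdAddChar (k v) := by
      intro k
      rw [prod_neg, prod_mul_distrib, prod_const, card_univ, hn, ← map_prod, ← mul_assoc,
        Polynomial.coeff_mul_X_pow', if_pos le_rfl, Nat.sub_self,
        show ((-1 : Polynomial ℂ) ^ n) = algebraMap ℂ _ ((-1) ^ n) by simp, ← map_mul]
      exact Polynomial.coeff_C_zero
    simp only [hL, ← mul_sum] at h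
    exact (mul_eq_zero.mp h).resolve_left (pow_ne_zero _ (by norm_num))
  · intro p hp
    rw [Polynomial.coeff_smul]
    by_cases hall : ∀ k ∈ p.2.parts, k = n
    · obtain hr := Multiset.eq_replicate_card.mpr hall
      have hr1 : Multiset.card p.2.parts ≠ 1 := fun h1 => hcon p hp (by rw [hr, h1]; rfl)
      rw [hr, Multiset.map_replicate, Multiset.prod_replicate, esymm_stdAddChar _ _ (NeZero.ne n),
        if_pos rfl, neg_pow, ← pow_mul,
        show ((-1 : Polynomial ℂ) ^ Multiset.card p.2.parts) =
          Polynomial.C ((-1) ^ Multiset.card p.2.parts) by simp, Polynomial.coeff_C_mul,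
        Polynomial.coeff_X_pow, if_neg, mul_zero, smul_zero]
      intro h1
      exact hr1 (Nat.eq_of_mul_eq_mul_left (NeZero.pos n) (by omega))
    · push Not at hall
      obtain ⟨k, hk, hkn⟩ := hall
      rw [Multiset.prod_eq_zero, Polynomial.coeff_zero, smul_zero]
      exact Multiset.mem_map.mpr ⟨k, hk, by
        rw [esymm_stdAddChar _ _ (p.2.parts_pos hk).ne', if_neg hkn]⟩

/-! ### Specialisation at two cycles of roots of unity -/

/-- The weights `-ω_a ^ i α` (`i : ZMod a`) and `-ω_b ^ j β` (`j : ZMod b`), where `α`, `β` are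
the two variables and `ω_a`, `ω_b` are primitive roots of unity. -/
noncomputable def twoCycleWeight (a b : ℕ) [NeZero a] [NeZero b] :
    ZMod a ⊕ ZMod b → MvPolynomial (Fin 2) ℂ :=
  Sum.elim (fun i => -(algebraMap ℂ _ (ZMod.stdAddChar i) * MvPolynomial.X 0))
    (fun j => -(algebraMap ℂ _ (ZMod.stdAddChar j) * MvPolynomial.X 1))

/-- The substitution `S ↦ -α ^ a`, `T ↦ -β ^ b`. -/
noncomputable def negPowHom (a b : ℕ) : MvPolynomial (Fin 2) ℕ →+* MvPolynomial (Fin 2) ℂ :=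
  MvPolynomial.eval₂Hom (Nat.castRingHom _) ![-MvPolynomial.X 0 ^ a, -MvPolynomial.X 1 ^ b]

/-- Only the monomial `S T` reaches `α^a β^b`, and its two minus signs cancel. This is the source of
positivity. -/
theorem coeff_negPowHom {a b : ℕ} (ha : 0 < a) (hb : 0 < b) (q : MvPolynomial (Fin 2) ℕ) :
    (negPowHom a b q).coeff (Finsupp.single 0 a + Finsupp.single 1 b) =
      ((q.coeff (Finsupp.single 0 1 + Finsupp.single 1 1) : ℕ) : ℂ) := by
  induction q using MvPolynomial.induction_on' with
  | add p q hp hq => rw [map_add, MvPolynomial.coeff_add, MvPolynomial.coeff_add, hp, hq]; simp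
  | monomial m r =>
    have h1 : negPowHom a b (MvPolynomial.monomial m r) =
        MvPolynomial.monomial (Finsupp.single 0 (a * m 0) + Finsupp.single 1 (b * m 1))
          ((r : ℂ) * ((-1) ^ m 0 * (-1) ^ m 1)) := by
      rw [negPowHom, MvPolynomial.coe_eval₂Hom, MvPolynomial.eval₂_monomial,
        Finsupp.prod_fintype _ _ (by simp), Fin.prod_univ_two]
      simp only [Matrix.cons_val_zero, Matrix.cons_val_one]
      rw [neg_pow, neg_pow (_ ^ b), ← pow_mul, ← pow_mul, MvPolynomial.X_pow_eq_monomial,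
        MvPolynomial.X_pow_eq_monomial, mul_mul_mul_comm, MvPolynomial.monomial_mul, one_mul,
        ← mul_assoc, ← MvPolynomial.C_mul_monomial, ← mul_one (_ * _ : ℂ),
        ← MvPolynomial.C_mul_monomial]
      simp [mul_assoc]
    rw [h1, MvPolynomial.coeff_monomial, MvPolynomial.coeff_monomial]
    by_cases hm : m = Finsupp.single 0 1 + Finsupp.single 1 1
    · subst hm; simp
    · rw [if_neg hm, if_neg, Nat.cast_zero]
      intro h
      apply hm
      have h0 := DFunLike.congr_fun h 0
      have h1 := DFunLike.congr_fun h 1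
      simp at h0 h1
      ext i
      fin_cases i
      · simpa using Nat.eq_of_mul_eq_mul_left ha (h0.trans (mul_one a).symm)
      · simpa using Nat.eq_of_mul_eq_mul_left hb (h1.trans (mul_one b).symm)

theorem prod_X_add_C_twoCycleWeight (a b : ℕ) [NeZero a] [NeZero b] :
    ∏ i, (Polynomial.X + Polynomial.C (twoCycleWeight a b i)) =
      ((Polynomial.X ^ a + Polynomial.C (MvPolynomial.X 0 : MvPolynomial (Fin 2) ℕ)) *
        (Polynomial.X ^ b + Polynomial.C (MvPolynomial.X 1))).map (negPowHom a b) := by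
  rw [Fintype.prod_sum_type]
  simp only [twoCycleWeight, Sum.elim_inl, Sum.elim_inr]
  rw [prod_X_add_C_stdAddChar, prod_X_add_C_stdAddChar]
  simp [negPowHom, sub_eq_add_neg]

theorem esymm_twoCycleWeight_mem_range (a b : ℕ) [NeZero a] [NeZero b] (k : ℕ) :
    (univ.val.map (twoCycleWeight a b)).esymm k ∈ (negPowHom a b).rangeS := by
  rcases lt_or_ge (Fintype.card (ZMod a ⊕ ZMod b)) k with h | h
  · rw [esymm_eq_zero_of_card_lt _ h]
    exact zero_mem _
  · rw [esymm_eq_coeff_prod _ h, prod_X_add_C_twoCycleWeight, Polynomial.coeff_map]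
    exact ⟨_, rfl⟩

theorem esymm_twoCycleWeight_add (a b : ℕ) [NeZero a] [NeZero b] :
    (univ.val.map (twoCycleWeight a b)).esymm (a + b) =
      negPowHom a b (MvPolynomial.X 0 * MvPolynomial.X 1) := by
  have h : Fintype.card (ZMod a ⊕ ZMod b) = a + b := by simp [ZMod.card]
  rw [esymm_eq_coeff_prod _ h.ge, prod_X_add_C_twoCycleWeight, Polynomial.coeff_map, h,
    Nat.sub_self, Polynomial.mul_coeff_zero]
  simp [Polynomial.coeff_X_pow, (NeZero.ne a).symm, (NeZero.ne b).symm]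

theorem exists_coeff_prod_esymm_eq (a b : ℕ) [NeZero a] [NeZero b] (s : Multiset ℕ) :
    ∃ r : ℕ, ((s.map (univ.val.map (twoCycleWeight a b)).esymm).prod).coeff
      (Finsupp.single 0 a + Finsupp.single 1 b) = (r : ℂ) := by
  have h : (s.map (univ.val.map (twoCycleWeight a b)).esymm).prod ∈ (negPowHom a b).rangeS :=
    multiset_prod_mem _ fun x hx => by
      obtain ⟨k, -, rfl⟩ := Multiset.mem_map.mp hx
      exact esymm_twoCycleWeight_mem_range a b k
  obtain ⟨q, hq⟩ := h
  exact ⟨_, by rw [← hq, coeff_negPowHom (NeZero.pos a) (NeZero.pos b)]⟩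

/-- A vanishing sum of nonnegative terms has all terms zero, and the term of `e_(a+b)` is its
coefficient times 1. -/
theorem coeff_eq_zero_of_parts_eq_singleton {a b : ℕ} [NeZero a] [NeZero b]
    {c : (Σ n : ℕ, n.Partition) →₀ ℚ} (hc : ∀ p, 0 ≤ c p)
    (h : (c.sum fun p x => x • (p.2.parts.map (univ.val.map (twoCycleWeight a b)).esymm).prod).coeff
      (Finsupp.single 0 a + Finsupp.single 1 b) = 0)
    (p : Σ n : ℕ, n.Partition) (hp : p.2.parts = {a + b}) : c p = 0 := by
  choose r hr using exists_coeff_prod_esymm_eq a b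
  rw [Finsupp.sum, MvPolynomial.coeff_sum] at h
  simp only [MvPolynomial.coeff_smul, hr, Rat.smul_def] at h
  have h' : ∑ p ∈ c.support, c p * (r p.2.parts : ℚ) = 0 := by exact_mod_cast h
  rw [sum_eq_zero_iff_of_nonneg fun p _ => mul_nonneg (hc p) (Nat.cast_nonneg _)] at h'
  by_contra hcp
  have h1 := h' p (Finsupp.mem_support_iff.mpr hcp)
  have h2 : (r p.2.parts : ℂ) = 1 := by
    have := coeff_negPowHom (NeZero.pos a) (NeZero.pos b) (MvPolynomial.X 0 * MvPolynomial.X 1)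
    rw [← hr, hp, Multiset.map_singleton, Multiset.prod_singleton, esymm_twoCycleWeight_add, this]
    rw [MvPolynomial.X, MvPolynomial.X, MvPolynomial.monomial_mul, MvPolynomial.coeff_monomial]
    simp
  have h3 : r p.2.parts = 1 := by exact_mod_cast h2
  rw [h3, Nat.cast_one, mul_one] at h1
  exact hcp h1

/-! ### Cancellation over disconnected blocks -/

/-- If applying a permutation of the colours on `D` preserves a set `T` of colourings and
multiplies the weight of each of them by the same factor other than `1`, then the weights of the
colourings in `T` add up to zero. -/
theorem sum_prod_eq_zero_of_shift {V σ : Type*} [Fintype V] [DecidableEq V] (π : Equiv.Perm σ)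
    (D : Finset V) (w : σ → ℂ) (ζ : ℂ) (hζ : ζ ^ #D ≠ 1) (T : Finset (V → σ))
    (hT : ∀ k ∈ T, (fun v => if v ∈ D then π (k v) else k v) ∈ T)
    (hw : ∀ k ∈ T, ∀ v ∈ D, w (π (k v)) = ζ * w (k v)) :
    ∑ k ∈ T, ∏ v, w (k v) = 0 := by
  classical
  let f : (V → σ) → V → σ := fun k v => if v ∈ D then π (k v) else k v
  have hf : Function.Injective f := by
    intro k l h
    funext v
    have := congrFun h v
    by_cases hv : v ∈ D
    · simpa [f, hv] using this
    · simpa [f, hv] using this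
  have himage : T.image f = T := eq_of_subset_of_card_le
    (fun l hl => by obtain ⟨k, hk, rfl⟩ := mem_image.mp hl; exact hT k hk)
    (card_image_of_injective _ hf).ge
  have hprod : ∀ k ∈ T, ∏ v, w (f k v) = ζ ^ #D * ∏ v, w (k v) := by
    intro k hk
    rw [← prod_mul_prod_compl D, ← prod_mul_prod_compl D (fun v => w (k v)), ← mul_assoc,
      ← prod_const, ← prod_mul_distrib]
    congr 1
    · exact prod_congr rfl fun v hv => by simp only [f, if_pos hv]; exact hw k hk v hv
    · exact prod_congr rfl fun v hv => by simp only [f, if_neg (mem_compl.mp hv)]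
  have h : ∑ k ∈ T, ∏ v, w (k v) = ζ ^ #D * ∑ k ∈ T, ∏ v, w (k v) := by
    conv_lhs => rw [← himage, sum_image fun k _ l _ h => hf h, sum_congr rfl hprod, ← mul_sum]
  by_contra h0
  exact hζ (mul_right_cancel₀ h0 (by rw [← h, one_mul]))

theorem exists_subset_not_adj_of_not_connected {V : Type*} [DecidableEq V] {G : SimpleGraph V}
    {A : Finset V} (hA : A.Nonempty) (h : ¬ (G.induce (A : Set V)).Connected) :
    ∃ D ⊆ A, D.Nonempty ∧ D ≠ A ∧ ∀ u ∈ D, ∀ v ∈ A, v ∉ D → ¬ G.Adj u v := by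
  classical
  have : Nonempty (A : Set V) := hA.to_subtype
  have h' : ¬ (G.induce (A : Set V)).Preconnected := fun hp => h ⟨hp⟩
  simp only [SimpleGraph.Preconnected, not_forall] at h'
  obtain ⟨x, y, hxy⟩ := h'
  -- The witness is the component of `x` in the induced graph; it misses `y`.
  refine ⟨A.filter fun v => ∃ hv : v ∈ (A : Set V), (G.induce (A : Set V)).Reachable x ⟨v, hv⟩,
    filter_subset _ _, ⟨x, mem_filter.mpr ⟨x.2, x.2, .rfl⟩⟩, fun heq => ?_, ?_⟩
  · have hy : y.1 ∈ A := y.2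
    obtain ⟨-, _, hxy'⟩ := mem_filter.mp (heq.ge hy)
    exact hxy hxy'
  · intro u hu v hv hvD huv
    obtain ⟨-, hu, hxu⟩ := mem_filter.mp hu
    refine hvD (mem_filter.mpr ⟨hv, hv, hxu.trans (SimpleGraph.Adj.reachable ?_)⟩)
    exact huv

/-- The two blocks use disjoint palettes. On a disconnected block, adding 1 to the colours of a
component `D` keeps the colouring proper and multiplies its weight by `ω^#D`, which is not 1 because
`#D` lies strictly between 0 and the block size. -/
theorem sum_two_blocks_eq_zero {V : Type*} [Fintype V] [DecidableEq V] {G : SimpleGraph V} {a b : ℕ} [NeZero a]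
    [NeZero b] {A : Finset V} (hA : #A = a) (hB : #Aᶜ = b)
    (h : ¬ ((G.induce (A : Set V)).Connected ∧ (G.induce (Aᶜ : Finset V) : SimpleGraph
      ((Aᶜ : Finset V) : Set V)).Connected)) :
    ∑ k ∈ properColorings G (ZMod a ⊕ ZMod b) with (univ.filter fun v => (k v).isLeft) = A,
      ∏ v, Sum.elim (ZMod.stdAddChar : ZMod a → ℂ) (ZMod.stdAddChar : ZMod b → ℂ) (k v) = 0 := by
  have hroot : ∀ (n m : ℕ) [NeZero n], 0 < m → m < n →
      (ZMod.stdAddChar (1 : ZMod n) : ℂ) ^ m ≠ 1 := by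
    intro n m _ hm hmn h1
    rw [← AddChar.map_nsmul_eq_pow, ← AddChar.map_zero_eq_one (ZMod.stdAddChar (N := n))] at h1
    have h2 := ZMod.injective_stdAddChar h1
    rw [nsmul_one, ZMod.natCast_eq_zero_iff] at h2
    exact absurd (Nat.le_of_dvd hm h2) (by omega)
  -- Here `l` tells which block contains `D`: `true` for `A`, `false` for its complement.
  have key : ∀ (D : Finset V) (π : Equiv.Perm (ZMod a ⊕ ZMod b)) (l : Bool) (ζ : ℂ),
      (∀ x, (π x).isLeft = x.isLeft) → (∀ x, x.isLeft = l →
        Sum.elim (ZMod.stdAddChar : ZMod a → ℂ) (ZMod.stdAddChar : ZMod b → ℂ) (π x) =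
        ζ * Sum.elim (ZMod.stdAddChar : ZMod a → ℂ) (ZMod.stdAddChar : ZMod b → ℂ) x) →
      ζ ^ #D ≠ 1 → (∀ v ∈ D, (decide (v ∈ A)) = l) →
      (∀ u ∈ D, ∀ v, decide (v ∈ A) = l → v ∉ D → ¬ G.Adj u v) →
      ∑ k ∈ properColorings G (ZMod a ⊕ ZMod b) with (univ.filter fun v => (k v).isLeft) = A,
      ∏ v, Sum.elim (ZMod.stdAddChar : ZMod a → ℂ) (ZMod.stdAddChar : ZMod b → ℂ) (k v) = 0 := by
    intro D π l ζ hπ hw hζ hD hadj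
    have hside : ∀ k : V → ZMod a ⊕ ZMod b, (univ.filter fun v => (k v).isLeft) = A →
        ∀ v, (k v).isLeft = decide (v ∈ A) := by
      rintro k rfl v
      simp
    refine sum_prod_eq_zero_of_shift π D _ ζ hζ _ ?_ ?_
    · intro k hk
      obtain ⟨hk, hkA⟩ := mem_filter.mp hk
      -- An edge leaving `D` must go to the other block, where colours come from the other palette.
      have hcross : ∀ u v, G.Adj u v → u ∈ D → v ∉ D → π (k u) ≠ k v := by
        intro u v huv hu hv heq
        have h1 := congrArg Sum.isLeft heq
        rw [hπ, hside k hkA, hside k hkA, hD u hu] at h1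
        exact hadj u hu v h1.symm hv huv
      refine mem_filter.mpr ⟨mem_properColorings.mpr fun u v huv => ?_, ?_⟩
      · have h0 := mem_properColorings.mp hk u v huv
        by_cases hu : u ∈ D <;> by_cases hv : v ∈ D
        · simpa [hu, hv] using h0
        · simpa [hu, hv] using hcross u v huv hu hv
        · simpa [hu, hv] using (hcross v u huv.symm hv hu).symm
        · simpa [hu, hv] using h0
      · rw [← hkA]
        refine filter_congr fun v _ => ?_
        dsimp only
        split_ifs
        · rw [hπ]
        · rfl
    · intro k hk v hv
      obtain ⟨hk, hkA⟩ := mem_filter.mp hk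
      exact hw _ (by rw [hside k hkA, hD v hv])
  rw [not_and_or] at h
  rcases h with h | h
  · obtain ⟨D, hDA, hne, hneA, hD⟩ := exists_subset_not_adj_of_not_connected
      (card_pos.mp (hA ▸ NeZero.pos a)) h
    refine key D (Equiv.sumCongr (Equiv.addLeft 1) (Equiv.refl _)) true
      (ZMod.stdAddChar (1 : ZMod a)) ?_ ?_ (hroot a _ hne.card_pos ?_) ?_ ?_
    · rintro (x | x) <;> rfl
    · rintro (x | x) hx
      · simp [AddChar.map_add_eq_mul]
      · simp at hx
    · exact hA ▸ card_lt_card (hDA.ssubset_of_ne hneA)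
    · exact fun v hv => by simpa using hDA hv
    · exact fun u hu v hv => hD u hu v (by simpa using hv)
  · obtain ⟨D, hDA, hne, hneA, hD⟩ := exists_subset_not_adj_of_not_connected
      (card_pos.mp (hB ▸ NeZero.pos b)) h
    refine key D (Equiv.sumCongr (Equiv.refl _) (Equiv.addLeft 1)) false
      (ZMod.stdAddChar (1 : ZMod b)) ?_ ?_ (hroot b _ hne.card_pos ?_) ?_ ?_
    · rintro (x | x) <;> rfl
    · rintro (x | x) hx
      · simp at hx
      · simp [AddChar.map_add_eq_mul]
    · exact hB ▸ card_lt_card (hDA.ssubset_of_ne hneA)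
    · exact fun v hv => by simpa using hDA hv
    · exact fun u hu v hv => hD u hu v (by simpa using hv)

/-! ### The criterion for two-part types -/

theorem hasConnectedPartition_pair {V : Type*} [Fintype V] [DecidableEq V] {G : SimpleGraph V}
    {A : Finset V} (hA : (G.induce (A : Set V)).Connected)
    (hB : (G.induce ((Aᶜ : Finset V) : Set V)).Connected) :
    HasConnectedPartition G {#A, #Aᶜ} := by
  have hAne : A ≠ ∅ := by
    rintro rfl
    obtain ⟨x, hx⟩ := hA.nonempty
    simp at hx
  have hBne : Aᶜ ≠ ∅ := by
    intro h
    obtain ⟨x, hx⟩ := hB.nonempty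
    simp [h] at hx
  have hne : A ≠ Aᶜ := fun h => hAne (disjoint_self.mp ((disjoint_compl_right (a := A)).mono_right h.le))
  let P : Finpartition (univ : Finset V) :=
    { parts := {A, Aᶜ}
      supIndep := by
        rw [supIndep_pair hne]
        exact disjoint_compl_right
      sup_parts := by simp
      bot_notMem := by
        simp only [mem_insert, mem_singleton, not_or]
        exact ⟨hAne.symm, hBne.symm⟩ }
  refine ⟨P, ?_, ?_⟩
  · intro B hB'
    rcases mem_insert.mp hB' with rfl | hB'
    · exact hA
    · rw [mem_singleton.mp hB']; exact hB
  · change (({A, Aᶜ} : Finset (Finset V)).val.map card) = _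
    rw [insert_val_of_notMem (by simpa using hne)]
    rfl

/-- An `e`-positive graph on `a + b` vertices whose cyclic colouring sum does not vanish has a
connected partition of type `(a, b)`. -/
theorem EPositive.hasConnectedPartition_pair {V : Type*} [Fintype V] [DecidableEq V]
    {G : SimpleGraph V} {a b : ℕ} (ha : 0 < a) (hb : 0 < b) (hV : Fintype.card V = a + b)
    [NeZero (a + b)] (hG : cyclicColoringSum G (a + b) ≠ 0) (h : EPositive (chromaticSymm G)) :
    HasConnectedPartition G {a, b} := by
  classical
  by_contra hcon
  have : NeZero a := ⟨ha.ne'⟩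
  have : NeZero b := ⟨hb.ne'⟩
  obtain ⟨c, hc0, hc⟩ := h
  obtain ⟨p, hp, hpp⟩ := exists_parts_eq_singleton hV hG hc
  refine Finsupp.mem_support_iff.mp hp (coeff_eq_zero_of_parts_eq_singleton hc0 ?_ p hpp)
  rw [← sum_properColorings_eq hc, MvPolynomial.coeff_sum]
  -- The monomial `α^a β^b` selects the colourings that use the left palette on exactly `a`
  -- vertices.
  have hL : ∀ k : V → ZMod a ⊕ ZMod b, (∏ v, twoCycleWeight a b (k v)).coeff
      (Finsupp.single 0 a + Finsupp.single 1 b) =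
      if #(univ.filter fun v => (k v).isLeft) = a then (-1) ^ (a + b) *
        ∏ v, Sum.elim (ZMod.stdAddChar : ZMod a → ℂ) (ZMod.stdAddChar : ZMod b → ℂ) (k v)
      else 0 := by
    intro k
    have h1 : ∀ x : ZMod a ⊕ ZMod b, twoCycleWeight a b x =
        MvPolynomial.monomial (if x.isLeft then Finsupp.single 0 1 else Finsupp.single 1 1)
        (-Sum.elim (ZMod.stdAddChar : ZMod a → ℂ) (ZMod.stdAddChar : ZMod b → ℂ) x) := by
      rintro (x | x) <;>
      · simp only [twoCycleWeight, Sum.elim_inl, Sum.elim_inr, MvPolynomial.algebraMap_eq,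
          MvPolynomial.X, MvPolynomial.C_mul_monomial, map_neg, mul_one]
        rfl
    have h2 : (∑ v, if (k v).isLeft then Finsupp.single (0 : Fin 2) 1 else Finsupp.single 1 1) =
        Finsupp.single 0 #(univ.filter fun v => (k v).isLeft) +
          Finsupp.single 1 #(univ.filter fun v => ¬ (k v).isLeft) := by
      rw [sum_ite, sum_const, sum_const]
      simp
    have h3 := card_filter_add_card_filter_not (s := univ) (fun v => (k v).isLeft = true)
    rw [card_univ, hV] at h3
    simp only [h1]
    rw [← MvPolynomial.monomial_sum_prod, h2, MvPolynomial.coeff_monomial, prod_neg,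
      card_univ, hV]
    refine if_congr ⟨fun h => ?_, fun h => ?_⟩ rfl rfl
    · simpa using DFunLike.congr_fun h 0
    · rw [h, show #(univ.filter fun v => ¬ (k v).isLeft) = b by omega]
  simp only [hL]
  rw [← sum_filter, ← mul_sum, ← sum_fiberwise_of_maps_to
    (g := fun k => univ.filter fun v => (k v).isLeft)
    (t := univ.filter fun A : Finset V => #A = a) (fun k hk => by simpa using (mem_filter.mp hk).2)]
  rw [sum_eq_zero, mul_zero]
  intro A hA
  have hA : #A = a := by simpa using hA
  have hB : #Aᶜ = b := by rw [card_compl]; omega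
  rw [filter_filter, ← sum_two_blocks_eq_zero hA hB (G := G) fun h => hcon ?_]
  · refine sum_congr (filter_congr fun k _ => ⟨fun h => h.2, fun h => ⟨?_, h⟩⟩) fun _ _ => rfl
    rw [h, hA]
  · have := _root_.hasConnectedPartition_pair h.1 h.2
    rwa [hA, hB] at this

/-! ### The cyclic colouring sum of a sun -/

theorem sum_stdAddChar_mul {n : ℕ} [NeZero n] {m : ℕ} (hm : ¬ n ∣ m) :
    ∑ x : ZMod n, ZMod.stdAddChar ((m : ZMod n) * x) = (0 : ℂ) := by
  have h := AddChar.sum_mulShift (m : ZMod n) (ZMod.isPrimitive_stdAddChar n)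
  rw [if_neg (by rwa [ZMod.natCast_eq_zero_iff])] at h
  rw [Nat.cast_zero] at h
  rw [← h]
  exact sum_congr rfl fun x _ => by rw [mul_comm]

-- Peel off the first vertex. Since the full character sum with multiplier `l + 1 < n` vanishes,
-- summing over the colours `d ≠ c` of the next vertex leaves minus the term at `c`. So a ray acts
-- as a weight on its body vertex, up to sign.
open Classical in
theorem sum_path_colorings {n : ℕ} [NeZero n] (l : ℕ) (hl : l < n) (c : ZMod n) :
    ∑ f : Fin (l + 1) → ZMod n with f 0 = c ∧ ∀ i : Fin l, f i.castSucc ≠ f i.succ,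
      ∏ i, ZMod.stdAddChar (f i) = (-1) ^ l * (ZMod.stdAddChar (((l + 1 : ℕ) : ZMod n) * c) : ℂ) := by
  induction l generalizing c with
  | zero =>
    rw [sum_filter, ← (Equiv.funUnique (Fin 1) (ZMod n)).symm.sum_comp]
    simp [Equiv.funUnique, uniqueElim]
  | succ l ih =>
    rw [sum_filter, ← (Fin.consEquiv fun _ => ZMod n).sum_comp, Fintype.sum_prod_type]
    have hstep : ∀ (x : ZMod n) (g : Fin (l + 1) → ZMod n),
        (if (Fin.consEquiv (fun _ : Fin (l + 2) => ZMod n) (x, g)) 0 = c ∧ ∀ i : Fin (l + 1),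
          Fin.consEquiv (fun _ : Fin (l + 2) => ZMod n) (x, g) i.castSucc ≠
            Fin.consEquiv (fun _ : Fin (l + 2) => ZMod n) (x, g) i.succ
          then ∏ i, ZMod.stdAddChar (Fin.consEquiv (fun _ : Fin (l + 2) => ZMod n) (x, g) i)
          else (0 : ℂ)) =
        if x = c then ∑ d ∈ univ.erase c, if g 0 = d ∧ ∀ i : Fin l, g i.castSucc ≠ g i.succ
          then ZMod.stdAddChar c * ∏ i, ZMod.stdAddChar (g i) else 0 else 0 := by
      intro x g
      rw [Fin.prod_univ_succ]
      simp only [Fin.consEquiv_apply, Fin.cons_zero, Fin.cons_succ, Fin.forall_fin_succ,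
        Fin.castSucc_zero, ← Fin.succ_castSucc]
      by_cases hx : x = c
      · subst hx
        by_cases hg : ∀ i : Fin l, g i.castSucc ≠ g i.succ
        · simp [hg, eq_comm]
        · simp [hg]
      · simp [hx]
    simp only [hstep]
    rw [sum_eq_single c (fun x _ hx => by simp [hx]) (by simp)]
    simp only [if_true]
    rw [sum_comm]
    simp only [← sum_filter, ← mul_sum, ih (by omega)]
    rw [sum_erase_eq_sub (mem_univ c), sum_stdAddChar_mul
      (fun h => absurd (Nat.le_of_dvd (Nat.succ_pos l) h) (by omega)), zero_sub, mul_neg, mul_neg,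
      mul_left_comm, ← AddChar.map_add_eq_mul, pow_succ]
    push_cast
    ring_nf

/-- Summing out `c 2` and then `c 1`, the full character sums vanish because their multipliers lie
strictly between 0 and `n`. The excluded colours leave `2 ω^(n c 0) = 2` for each `c 0`. -/
theorem sum_triangle_colorings {n : ℕ} [NeZero n] (m : Fin 3 → ℕ) (hm : ∀ i, 0 < m i)
    (hsum : ∑ i, m i = n) :
    ∑ c : Fin 3 → ZMod n with c 0 ≠ c 1 ∧ c 0 ≠ c 2 ∧ c 1 ≠ c 2,
      ∏ i, (ZMod.stdAddChar ((m i : ZMod n) * c i) : ℂ) = 2 * n := by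
  rw [Fin.sum_univ_three] at hsum
  have hz : ∀ k, 0 < k → k < n → ∑ x : ZMod n, ZMod.stdAddChar ((k : ZMod n) * x) = (0 : ℂ) :=
    fun k hk hkn => sum_stdAddChar_mul fun h => absurd (Nat.le_of_dvd hk h) (by omega)
  have h0 := hm 0
  have h1 := hm 1
  have h2 := hm 2
  have e : ∀ (k l : ℕ) (x : ZMod n), ZMod.stdAddChar ((k : ZMod n) * x) * ZMod.stdAddChar ((l : ZMod n) * x) =
      (ZMod.stdAddChar (((k + l : ℕ) : ZMod n) * x) : ℂ) := fun k l x => by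
    rw [← AddChar.map_add_eq_mul, ← add_mul, Nat.cast_add]
  have hone : ∀ x : ZMod n, (ZMod.stdAddChar (((m 0 + m 1 + m 2 : ℕ) : ZMod n) * x) : ℂ) = 1 := fun x => by
    rw [hsum, CharP.cast_eq_zero, zero_mul, AddChar.map_zero_eq_one]
  have hinner : ∀ x y : ZMod n, ∑ z, (if z ≠ x ∧ z ≠ y then
      (ZMod.stdAddChar ((m 2 : ZMod n) * z) : ℂ) else 0) =
      if x = y then -ZMod.stdAddChar ((m 2 : ZMod n) * x) else
        -ZMod.stdAddChar ((m 2 : ZMod n) * x) - ZMod.stdAddChar ((m 2 : ZMod n) * y) := by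
    intro x y
    by_cases hxy : x = y
    · subst hxy
      simp only [and_self, if_true]
      rw [← sum_filter, filter_ne', sum_erase_eq_sub (mem_univ x), hz _ h2 (by omega), zero_sub]
    · rw [if_neg hxy, ← sum_filter, show (univ.filter fun z => z ≠ x ∧ z ≠ y) =
        (univ.erase x).erase y by ext z; simp [and_comm],
        sum_erase_eq_sub (by simp [Ne.symm hxy]), sum_erase_eq_sub (mem_univ x),
        hz _ h2 (by omega), zero_sub]
  have hmid : ∀ x : ZMod n, ∑ y ∈ univ.erase x, (ZMod.stdAddChar ((m 1 : ZMod n) * y) : ℂ) *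
      (-ZMod.stdAddChar ((m 2 : ZMod n) * x) - ZMod.stdAddChar ((m 2 : ZMod n) * y)) =
      2 * ZMod.stdAddChar (((m 1 + m 2 : ℕ) : ZMod n) * x) := by
    intro x
    simp only [mul_sub, mul_neg, e]
    rw [sum_sub_distrib, sum_neg_distrib, ← sum_mul, sum_erase_eq_sub (mem_univ x),
      sum_erase_eq_sub (mem_univ x), hz _ h1 (by omega), hz _ (by omega) (by omega), ← e]
    ring
  rw [sum_filter, ← (Fin.consEquiv fun _ => ZMod n).sum_comp, Fintype.sum_prod_type]
  have hsplit : ∀ x : ZMod n, ∑ g : Fin 2 → ZMod n,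
      (if (Fin.consEquiv (fun _ => ZMod n) (x, g) : Fin 3 → ZMod n) 0 ≠
          (Fin.consEquiv (fun _ => ZMod n) (x, g) : Fin 3 → ZMod n) 1 ∧
        (Fin.consEquiv (fun _ => ZMod n) (x, g) : Fin 3 → ZMod n) 0 ≠
          (Fin.consEquiv (fun _ => ZMod n) (x, g) : Fin 3 → ZMod n) 2 ∧
        (Fin.consEquiv (fun _ => ZMod n) (x, g) : Fin 3 → ZMod n) 1 ≠
          (Fin.consEquiv (fun _ => ZMod n) (x, g) : Fin 3 → ZMod n) 2
      then ∏ i, (ZMod.stdAddChar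
        ((m i : ZMod n) * (Fin.consEquiv (fun _ => ZMod n) (x, g) : Fin 3 → ZMod n) i) : ℂ) else 0) =
      ZMod.stdAddChar ((m 0 : ZMod n) * x) * ∑ y ∈ univ.erase x, (ZMod.stdAddChar ((m 1 : ZMod n) * y) : ℂ) *
      (-ZMod.stdAddChar ((m 2 : ZMod n) * x) - ZMod.stdAddChar ((m 2 : ZMod n) * y)) := by
    intro x
    rw [← (finTwoArrowEquiv (ZMod n)).symm.sum_comp, Fintype.sum_prod_type, mul_sum,
      ← filter_ne', sum_filter]
    refine sum_congr rfl fun y _ => ?_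
    by_cases hyx : y = x
    · subst hyx
      simp [Fin.consEquiv]
    · rw [if_pos hyx, ← (hinner x y).trans (if_neg (Ne.symm hyx)), mul_sum, mul_sum]
      refine sum_congr rfl fun z _ => ?_
      rw [mul_ite, mul_zero, mul_ite, mul_zero]
      refine if_congr ?_ ?_ rfl
      · simp [Fin.consEquiv, Fin.cons, Fin.cases, Fin.induction, Fin.induction.go]
        tauto
      · rw [Fin.prod_univ_three, mul_assoc]
        rfl
  simp only [hsplit, hmid]
  have : ∀ x : ZMod n, (ZMod.stdAddChar ((m 0 : ZMod n) * x) : ℂ) *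
      (2 * ZMod.stdAddChar (((m 1 + m 2 : ℕ) : ZMod n) * x)) = 2 := fun x => by
    rw [mul_left_comm, e, ← add_assoc, hone, mul_one]
  simp only [this]
  simp [card_univ, ZMod.card, mul_comm]

theorem cycleGraph_three_adj {i j : Fin 3} (h : i ≠ j) : (SimpleGraph.cycleGraph 3).Adj i j := by
  revert i j
  decide

theorem forall_sunGraph_adj_ne_iff {σ : Type*} (r : Fin 3 → ℕ) (k : SunVertex 3 r → σ) :
    (∀ u v, (sunGraph 3 r).Adj u v → k u ≠ k v) ↔
      (k ⟨0, 0⟩ ≠ k ⟨1, 0⟩ ∧ k ⟨0, 0⟩ ≠ k ⟨2, 0⟩ ∧ k ⟨1, 0⟩ ≠ k ⟨2, 0⟩) ∧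
        ∀ i, ∀ j : Fin (r i), k ⟨i, j.castSucc⟩ ≠ k ⟨i, j.succ⟩ := by
  constructor
  · intro h
    refine ⟨⟨?_, ?_, ?_⟩, fun i j => h _ _ (Or.inr ⟨rfl, Or.inl ?_⟩)⟩
    · exact h _ _ (Or.inl ⟨rfl, rfl, cycleGraph_three_adj (by simp)⟩)
    · exact h _ _ (Or.inl ⟨rfl, rfl, cycleGraph_three_adj (by simp)⟩)
    · exact h _ _ (Or.inl ⟨rfl, rfl, cycleGraph_three_adj (by simp)⟩)
    · simp
  · rintro ⟨⟨h01, h02, h12⟩, hpath⟩ ⟨i, x⟩ ⟨j, y⟩ (⟨hx, hy, hij⟩ | ⟨hij, h⟩)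
    · obtain rfl : x = 0 := Fin.ext hx
      obtain rfl : y = 0 := Fin.ext hy
      have hne := hij.ne
      dsimp only at hne
      fin_cases i <;> fin_cases j <;>
        first | exact absurd rfl hne | exact h01 | exact h02 | exact h12 | exact h01.symm |
          exact h02.symm | exact h12.symm
    · dsimp only at hij
      subst hij
      dsimp only at h
      rcases h with h | h
      · obtain ⟨z, rfl, rfl⟩ : ∃ z : Fin (r i), x = z.castSucc ∧ y = z.succ :=
          ⟨⟨x, by omega⟩, rfl, Fin.ext h.symm⟩
        exact hpath i z
      · obtain ⟨z, rfl, rfl⟩ : ∃ z : Fin (r i), y = z.castSucc ∧ x = z.succ :=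
          ⟨⟨y, by omega⟩, rfl, Fin.ext h.symm⟩
        exact (hpath i z).symm

theorem cyclicColoringSum_sunGraph_ne_zero (r : Fin 3 → ℕ) (n : ℕ) [NeZero n]
    (hn : ∑ i, (r i + 1) = n) : cyclicColoringSum (sunGraph 3 r) n ≠ 0 := by
  classical
  have key : cyclicColoringSum (sunGraph 3 r) n =
      ∑ c : Fin 3 → ZMod n with c 0 ≠ c 1 ∧ c 0 ≠ c 2 ∧ c 1 ≠ c 2, ∏ i,
        ∑ f : Fin (r i + 1) → ZMod n with f 0 = c i ∧ ∀ j : Fin (r i), f j.castSucc ≠ f j.succ,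
          ∏ j, ZMod.stdAddChar (f j) := by
    have hprop : properColorings (sunGraph 3 r) (ZMod n) =
        univ.filter fun k => ∀ u v, (sunGraph 3 r).Adj u v → k u ≠ k v := by
      ext k
      simp [mem_properColorings]
    rw [cyclicColoringSum, hprop, sum_filter,
      ← (Equiv.piCurry fun (i : Fin 3) (_ : Fin (r i + 1)) => ZMod n).symm.sum_comp]
    have hc : ∀ c : Fin 3 → ZMod n, ∏ i,
        ∑ f : Fin (r i + 1) → ZMod n with f 0 = c i ∧ ∀ j : Fin (r i), f j.castSucc ≠ f j.succ,
          ∏ j, ZMod.stdAddChar (f j) = ∑ g : (∀ i, Fin (r i + 1) → ZMod n),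
          if (∀ i, g i 0 = c i) ∧ ∀ i, ∀ j : Fin (r i), g i j.castSucc ≠ g i j.succ then
            ∏ i, ∏ j, (ZMod.stdAddChar (g i j) : ℂ) else 0 := by
      intro c
      simp only [sum_filter]
      rw [Fintype.prod_sum]
      refine sum_congr rfl fun g _ => ?_
      rw [Fintype.prod_ite_zero]
      simp only [forall_and]
    simp only [hc]
    rw [sum_comm]
    refine sum_congr rfl fun g _ => ?_
    -- The auxiliary triangle colouring `c` is determined by the colouring `g` of the legs.
    rw [sum_filter, sum_eq_single (fun i => g i 0)]
    · rw [Fintype.prod_sigma, ← ite_and]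
      refine if_congr ?_ rfl rfl
      rw [forall_sunGraph_adj_ne_iff]
      simp [Equiv.piCurry, Sigma.uncurry]
    · intro c _ hc
      rw [if_neg (c := (∀ i, g i 0 = c i) ∧ _) fun h => hc (funext fun i => (h.1 i).symm), ite_self]
    · simp
  have hlt : ∀ i, r i < n := fun i => by
    rw [Fin.sum_univ_three] at hn
    fin_cases i <;> simp <;> omega
  rw [key]
  simp only [sum_path_colorings _ (hlt _), prod_mul_distrib, ← mul_sum]
  rw [sum_triangle_colorings (fun i => r i + 1) (fun i => Nat.succ_pos _) hn]
  refine mul_ne_zero (prod_ne_zero_iff.mpr fun i _ => pow_ne_zero _ (by norm_num)) ?_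
  exact mul_ne_zero two_ne_zero (Nat.cast_ne_zero.mpr (NeZero.ne n))

/-! ### Connected partitions of a sun -/

/-- A connected set of vertices of a sun which is larger than every leg (a body vertex together
with its ray) contains two body vertices. -/
theorem exists_body_ne_of_connected {n : ℕ} {r : Fin n → ℕ} {B : Finset (SunVertex n r)}
    (hB : ((sunGraph n r).induce (B : Set (SunVertex n r))).Connected)
    (hcard : ∀ i, r i + 1 < #B) :
    ∃ i j, i ≠ j ∧ (⟨i, 0⟩ : SunVertex n r) ∈ B ∧ (⟨j, 0⟩ : SunVertex n r) ∈ B := by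
  by_contra! hcon
  obtain ⟨x₀⟩ := hB.nonempty
  have hstep : ∀ x y : (B : Set (SunVertex n r)),
      ((sunGraph n r).induce (B : Set (SunVertex n r))).Adj x y → x.1.1 = y.1.1 := by
    rintro ⟨⟨i, x⟩, hx⟩ ⟨⟨j, y⟩, hy⟩ (⟨hx0, hy0, -⟩ | ⟨h, -⟩)
    · obtain rfl : x = 0 := Fin.ext hx0
      obtain rfl : y = 0 := Fin.ext hy0
      by_contra hij
      exact hcon i j hij hx hy
    · exact h
  have hleg : ∀ x ∈ B, x.1 = x₀.1.1 := by
    intro x hx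
    obtain ⟨p⟩ := hB.preconnected ⟨x, hx⟩ x₀
    have : ∀ u v, ((sunGraph n r).induce (B : Set (SunVertex n r))).Walk u v →
        u.1.1 = v.1.1 := by
      intro u v p
      induction p with
      | nil => rfl
      | cons h _ ih => exact (hstep _ _ h).trans ih
    exact this _ _ p
  have hsub : B ⊆ univ.image (Sigma.mk x₀.1.1) := by
    rintro ⟨i, x⟩ hx
    obtain rfl : i = x₀.1.1 := hleg _ hx
    exact mem_image_of_mem _ (mem_univ x)
  have := (card_le_card hsub).trans card_image_le
  rw [card_univ, Fintype.card_fin] at this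
  exact absurd (hcard x₀.1.1) (by omega)

theorem not_hasConnectedPartition_pair_sunGraph {r : Fin 3 → ℕ} {a b : ℕ}
    (ha : ∀ i, r i + 1 < a) (hb : ∀ i, r i + 1 < b) :
    ¬ HasConnectedPartition (sunGraph 3 r) {a, b} := by
  rintro ⟨P, hP, hcard⟩
  have hbody : ∀ B ∈ P.parts, ∃ i j, i ≠ j ∧ (⟨i, 0⟩ : SunVertex 3 r) ∈ B ∧
      (⟨j, 0⟩ : SunVertex 3 r) ∈ B := by
    intro B hB
    refine exists_body_ne_of_connected (hP B hB) fun i => ?_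
    have h : #B ∈ ({a, b} : Multiset ℕ) := hcard ▸ Multiset.mem_map_of_mem _ hB
    rcases Multiset.mem_cons.mp h with h | h
    · exact h ▸ ha i
    · exact Multiset.mem_singleton.mp h ▸ hb i
  have h2 : #P.parts = 2 := by simpa using congrArg Multiset.card hcard
  obtain ⟨A, B, hAB, hparts⟩ := card_eq_two.mp h2
  have hA : A ∈ P.parts := by simp [hparts]
  have hB : B ∈ P.parts := by simp [hparts]
  obtain ⟨i, j, hij, hi, hj⟩ := hbody A hA
  obtain ⟨k, l, hkl, hk, hl⟩ := hbody B hB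
  have hdisj := disjoint_left.mp (P.disjoint hA hB hAB)
  -- Two pairs of distinct elements of `Fin 3` must meet.
  rcases (by omega : i = k ∨ i = l ∨ j = k ∨ j = l) with rfl | rfl | rfl | rfl
  · exact hdisj hi hk
  · exact hdisj hi hl
  · exact hdisj hj hk
  · exact hdisj hj hl

theorem mainTheorem3 (l₁ l₂ l₃ : ℕ) (hmax : l₁ = max l₁ (max l₂ l₃)) (hlt : l₁ < l₂ + l₃) :
    ¬ HasConnectedPartition (sunGraph 3 ![l₁, l₂, l₃]) {l₂ + l₃ + 1, l₁ + 2} ∧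
      ¬ EPositive (chromaticSymm (sunGraph 3 ![l₁, l₂, l₃])) := by
  have hno : ¬ HasConnectedPartition (sunGraph 3 ![l₁, l₂, l₃]) {l₂ + l₃ + 1, l₁ + 2} := by
    -- The part `l₂ + l₃ + 1` exceeds every leg by `hlt`, the part `l₁ + 2` by maximality of `l₁`.
    apply not_hasConnectedPartition_pair_sunGraph <;>
    · intro i
      fin_cases i <;> simp <;> omega
  have hsum : ∑ i, ((![l₁, l₂, l₃] : Fin 3 → ℕ) i + 1) = l₂ + l₃ + 1 + (l₁ + 2) := by
    rw [Fin.sum_univ_three]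
    simp
    ring
  refine ⟨hno, fun h => hno ?_⟩
  have : NeZero (l₂ + l₃ + 1 + (l₁ + 2)) := ⟨by omega⟩
  exact h.hasConnectedPartition_pair (by omega) (by omega) (by simpa using hsum)
    (cyclicColoringSum_sunGraph_ne_zero _ _ hsum)
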